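/- Conventions. Rings are commutative with unit. A ring of prime characteristic $p$ is $F$-finite if the Frobenius endomorphism $r\mapsto r^{p^e}$ is a finite ring map for some (equivalently, every) $e>0$. For a prime $\mathfrak q$ of a ring $R$, $\kappa(\mathfrak q)=R_{\mathfrak q}/\mathfrak qR_{\mathfrak q}$ is its residue field, and $\operatorname{Min}(R)$ is the set of minimal primes of $R$. A Noetherian ring of finite Krull dimension is called equidimensional if all irreducible components of its spectrum have the same dimension; locally equidimensional if its localization at every prime is equidimensional; equicodimensional if all minimal irreducible closed subsets of its spectrum have the same codimension in it; and biequidimensional if all maximal chains of irreducible closed subsets of its spectrum have the same length. Let $A$ be an $F$-finite Noetherian domain of prime characteristic $p>0$ with fraction field $K$, let $A\subseteq R$ be a finite ring extension, and let $e>0$ be an integer. Then $A$ and $R$ have finite Krull dimension, the degrees $[K^{1/p^e}:K]$ and $[\kappa(\mathfrak q)^{1/p^e}:\kappa(\mathfrak q)]$ for $\mathfrak q\in\operatorname{Spec}(R)$ are finite, and the following hold. 1. For $\mathfrak p\in\operatorname{Spec}(R)$, $\dim(R/\mathfrak p)=\dim(R)$ if and only if $\mathfrak p\cap A=(0)$.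 2. $R$ is equidimensional if and only if $\mathfrak p\cap A=(0)$ for all $\mathfrak p\in\operatorname{Min}(R)$. 3. Suppose $A$ is equicodimensional and $R$ is locally equidimensional. Then $A$ is biequidimensional, and for all $\mathfrak p\in\operatorname{Min}(R)$ and all primes $\mathfrak q\supseteq\mathfrak p$ of $R$, $$[\kappa(\mathfrak q)^{1/p^e}:\kappa(\mathfrak q)]\,p^{e\dim(R_{\mathfrak q})}=[K^{1/p^e}:K]\,p^{e(\dim(R/\mathfrak p)-\dim(A))}.$$ 4. If $A$ is equicodimensional and $R$ is equidimensional, then $R$ is biequidimensional. 5. If $A$ is equicodimensional and $R$ is equidimensional, then the function $\operatorname{Spec}(R)\to\mathbb N$, $\mathfrak q\mapsto[\kappa(\mathfrak q)^{1/p^e}:\kappa(\mathfrak q)]\,p^{e\dim(R_{\mathfrak q})}$, is constant with value $[K^{1/p^e}:K]$. 6. If $A$ is equicodimensional, $R$ is locally equidimensional, and the function $\operatorname{Spec}(R)\to\mathbb N$, $\mathfrak q\mapsto[\kappa(\mathfrak q)^{1/p^e}:\kappa(\mathfrak q)]\,p^{e\dim(R_{\mathfrak q})}$, is constant, then $R$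 is equidimensional. -/

import Mathlib

open TopologicalSpace

/-- A space is equidimensional if all its irreducible components have the same dimension. -/
def IsEquidimensionalSpace (X : Type*) [TopologicalSpace X] : Prop :=
  ∀ Z ∈ irreducibleComponents X, ∀ Z' ∈ irreducibleComponents X,
    topologicalKrullDim Z = topologicalKrullDim Z'

/-- A space is equicodimensional if all its minimal irreducible closed subsets have the same
codimension; the codimension of `Z` is the supremum of the lengths of the chains
`Z = Z₀ ⊂ Z₁ ⊂ ⋯ ⊂ Zₙ` of irreducible closed subsets, that is, the coheight of `Z`. -/
def IsEquicodimensionalSpace (X : Type*) [TopologicalSpace X] : Prop :=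
  ∀ Z Z' : IrreducibleCloseds X, IsMin Z → IsMin Z' → Order.coheight Z = Order.coheight Z'

/-- A space is biequidimensional if all maximal chains of irreducible closed subsets have the
same length (equivalently, the same number of members). -/
def IsBiequidimensionalSpace (X : Type*) [TopologicalSpace X] : Prop :=
  ∀ c c' : Set (IrreducibleCloseds X),
    IsMaxChain (· ≤ ·) c → IsMaxChain (· ≤ ·) c' → c.encard = c'.encard

/-- A ring is equidimensional if its spectrum is. -/
def IsEquidimensionalRing (R : Type*) [CommRing R] : Prop :=
  IsEquidimensionalSpace (PrimeSpectrum R)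

/-- A ring is locally equidimensional if all its localizations at primes are equidimensional. -/
def IsLocallyEquidimensionalRing (R : Type*) [CommRing R] : Prop :=
  ∀ q : PrimeSpectrum R, IsEquidimensionalRing (Localization.AtPrime q.asIdeal)

/-- A ring is equicodimensional if its spectrum is. -/
def IsEquicodimensionalRing (R : Type*) [CommRing R] : Prop :=
  IsEquicodimensionalSpace (PrimeSpectrum R)

/-- A ring is biequidimensional if its spectrum is. -/
def IsBiequidimensionalRing (R : Type*) [CommRing R] : Prop :=
  IsBiequidimensionalSpace (PrimeSpectrum R)

/-- A ring of characteristic `p` is `F`-finite if the `e`-th Frobenius endomorphism `r ↦ r ^ p ^ e`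
is a finite map for some `e > 0`. -/
def IsFFinite (R : Type*) [CommRing R] (p : ℕ) [Fact p.Prime] [CharP R p] : Prop :=
  ∃ e : ℕ, 0 < e ∧ (iterateFrobenius R p e).Finite

/-- The degree `[k^{1/p^e} : k]`, where `k^{1/p^e}` is identified, as a `k`-module, with `F^e_* k`:
the abelian group `k` on which `a : k` acts as multiplication by `a ^ p ^ e`. -/
noncomputable def frobeniusDegree (k : Type*) [Field k] (p : ℕ) [Fact p.Prime] [CharP k p]
    (e : ℕ) : ℕ :=
  @Module.finrank k k _ _ (Module.compHom k (iterateFrobenius k p e))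

theorem charP_residueField {R : Type*} [CommRing R] (p : ℕ) [Fact p.Prime] [CharP R p]
    (q : PrimeSpectrum R) : CharP q.asIdeal.ResidueField p := by
  have h : ((p : ℕ) : q.asIdeal.ResidueField) = 0 := by
    rw [← map_natCast (algebraMap R q.asIdeal.ResidueField) p, CharP.cast_eq_zero, map_zero]
  exact (CharP.charP_iff_prime_eq_zero Fact.out).mpr h

/-- The degree `[κ(q)^{1/p^e} : κ(q)]` for a prime `q` of a ring of characteristic `p`. -/
noncomputable def residueDegree {R : Type*} [CommRing R] (p : ℕ) [Fact p.Prime] [CharP R p]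
    (e : ℕ) (q : PrimeSpectrum R) : ℕ :=
  haveI := charP_residueField p q
  frobeniusDegree q.asIdeal.ResidueField p e

/-- The Krull dimension of a nonzero ring of finite dimension, as a natural number. -/
noncomputable def natKrullDim (R : Type*) [CommRing R] : ℕ :=
  ((ringKrullDim R).unbotD 0).toNat

/-- The function `q ↦ [κ(q)^{1/p^e} : κ(q)] · p^{e · dim R_q}` on the spectrum of `R`. -/
noncomputable def kunzFunction {R : Type*} [CommRing R] (p : ℕ) [Fact p.Prime] [CharP R p]
    (e : ℕ) (q : PrimeSpectrum R) : ℕ :=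
  residueDegree p e q * p ^ (e * natKrullDim (Localization.AtPrime q.asIdeal))

-- Everything rests on one fact: in an `F`-finite Noetherian ring, if `q ⋖ q'` then the degree of
-- Frobenius on `κ(q)` is `p ^ e` times that on `κ(q')` (`residueDegree_of_covBy`). Here `S/q`
-- localized at `q'` is a one-dimensional local domain `B`. For nonzero `x` in its maximal ideal,
-- the length over `B` of `F^e_* B / x F^e_* B` is `[Frac B^{1/p^e} : Frac B] * ord x`; this
-- quotient is also `F^e_* (B / x^{p^e})`, of length `p^e * ord x * [k^{1/p^e} : k]`.
--
-- Thus `residueRank`, the base-`p` logarithm of the degree for `e = 1`, drops by exactly one along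
-- every covering of primes. Heights, coheights and lengths of maximal chains become differences of
-- ranks, once the ranks of the minimal or maximal primes involved agree.
--
-- A finite extension preserves coheights under contraction (going up, incomparability) and residue
-- degrees (finite field extensions have equal Frobenius degrees), so ranks in `R` are ranks in `A`.
-- Equicodimensionality of `A` makes the ranks of its maximal ideals agree; equidimensionality of
-- `R` says that its minimal primes contract to `⊥` and so have the rank of `⊥`.

universe u

/-! ### Posets with a rank function that drops by one along coverings -/

namespace Order

/-- A function that decreases along every covering relation of a strongly coatomic well-founded
order is strictly antitone. -/
theorem strictAnti_of_covBy {X : Type*} [PartialOrder X] [IsStronglyCoatomic X] [WellFoundedLT X]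
    {f : X → ℕ} (hf : ∀ x y, x ⋖ y → f y < f x) : StrictAnti f := by
  intro x y
  induction y using WellFoundedLT.induction with
  | ind y ih =>
    intro hxy
    obtain ⟨z, hxz, hzy⟩ := exists_le_covBy_of_lt hxy
    rcases hxz.eq_or_lt with rfl | hlt
    · exact hf _ _ hzy
    · exact (hf _ _ hzy).trans (ih z hzy.lt hlt)

/-- Each step up a chain lowers `f` by at least one, which bounds the height above; a step along a
covering lowers it by exactly one, so the bound is attained. -/
theorem height_add_eq {X : Type*} [PartialOrder X] [IsStronglyCoatomic X] [WellFoundedLT X]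
    {f : X → ℕ} (hf : StrictAnti f) (hcov : ∀ x y, x ⋖ y → f x = f y + 1) {c : ℕ} (y : X)
    (hc : ∀ z, IsMin z → z ≤ y → f z = c) : height y + f y = c := by
  induction y using WellFoundedLT.induction with
  | ind y ih =>
    by_cases hy : IsMin y
    · rw [height_eq_zero.mpr hy, hc y hy le_rfl, zero_add]
    have ih' : ∀ z < y, height z + f z = c := fun z hz ↦
      ih z hz fun w hw hwz ↦ hc w hw (hwz.trans hz.le)
    obtain ⟨z, hz⟩ := not_isMin_iff.mp hy
    obtain ⟨x, -, hx⟩ := exists_le_covBy_of_lt hz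
    have hxc := ih' x hx.lt
    have hfx := hcov x y hx
    have hx1 := height_add_one_le hx.lt
    obtain ⟨m, hm⟩ : ∃ m : ℕ, height x = m :=
      ENat.ne_top_iff_exists.mp (fun h ↦ by simp [h] at hxc) |>.imp fun _ h ↦ h.symm
    rw [hm] at hxc hx1
    have hmc : m + f x = c := by exact_mod_cast hxc
    have hle : height y ≤ ((m + 1 : ℕ) : ℕ∞) := by
      refine height_le_coe_iff.mpr fun w hw ↦ ?_
      have hwc := ih' w hw
      obtain ⟨k, hk⟩ : ∃ k : ℕ, height w = k :=
        ENat.ne_top_iff_exists.mp (fun h ↦ by simp [h] at hwc) |>.imp fun _ h ↦ h.symm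
      rw [hk] at hwc ⊢
      have hkc : k + f w = c := by exact_mod_cast hwc
      have := hf hw
      exact_mod_cast (by omega : k < m + 1)
    have hy1 : height y = ((m + 1 : ℕ) : ℕ∞) := le_antisymm hle (by exact_mod_cast hx1)
    rw [hy1]
    exact_mod_cast (by omega : m + 1 + f y = c)

theorem coheight_add_eq {X : Type*} [PartialOrder X] [IsStronglyAtomic X] [WellFoundedGT X]
    {f : X → ℕ} (hf : StrictAnti f) (hcov : ∀ x y, x ⋖ y → f x = f y + 1) {c : ℕ} (y : X)
    (hc : ∀ z, IsMax z → y ≤ z → f z = c) : coheight y + c = f y := by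
  induction y using WellFoundedGT.induction with
  | ind y ih =>
    by_cases hy : IsMax y
    · rw [coheight_eq_zero.mpr hy, hc y hy le_rfl, zero_add]
    have ih' : ∀ z > y, coheight z + c = f z := fun z hz ↦
      ih z hz fun w hw hwz ↦ hc w hw (hz.le.trans hwz)
    obtain ⟨z, hz⟩ := not_isMax_iff.mp hy
    obtain ⟨x, hx, -⟩ := exists_covBy_le_of_lt hz
    have hxc := ih' x hx.lt
    have hfx := hcov y x hx
    have hx1 := coheight_add_one_le hx.lt
    obtain ⟨m, hm⟩ : ∃ m : ℕ, coheight x = m :=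
      ENat.ne_top_iff_exists.mp (fun h ↦ by simp [h] at hxc) |>.imp fun _ h ↦ h.symm
    rw [hm] at hxc hx1
    have hmc : m + c = f x := by exact_mod_cast hxc
    have hle : coheight y ≤ ((m + 1 : ℕ) : ℕ∞) := by
      refine coheight_le_coe_iff.mpr fun w hw ↦ ?_
      have hwc := ih' w hw
      obtain ⟨k, hk⟩ : ∃ k : ℕ, coheight w = k :=
        ENat.ne_top_iff_exists.mp (fun h ↦ by simp [h] at hwc) |>.imp fun _ h ↦ h.symm
      rw [hk] at hwc ⊢
      have hkc : k + c = f w := by exact_mod_cast hwc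
      have := hf hw
      exact_mod_cast (by omega : k < m + 1)
    have hy1 : coheight y = ((m + 1 : ℕ) : ℕ∞) := le_antisymm hle (by exact_mod_cast hx1)
    rw [hy1]
    exact_mod_cast (by omega : m + 1 + c = f y)

end Order

theorem IsMaxChain.mem_of_forall {X : Type*} [PartialOrder X] {c : Set X}
    (hc : IsMaxChain (· ≤ ·) c) {z : X} (hz : ∀ x ∈ c, z ≤ x ∨ x ≤ z) : z ∈ c := by
  rw [hc.2 (hc.1.insert fun x hx _ ↦ hz x hx) (Set.subset_insert z c)]
  exact Set.mem_insert _ _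

/-- On a maximal chain `f` is injective, and its values fill the interval from `f b` to `f a`: a gap
would produce a covering pair along which `f` drops by more than one. -/
theorem IsMaxChain.exists_encard_eq {X : Type*} [PartialOrder X] [Nonempty X] {f : X → ℕ}
    (hf : StrictAnti f) (hcov : ∀ x y, x ⋖ y → f x = f y + 1) {N : ℕ} (hN : ∀ x, f x ≤ N)
    {c : Set X} (hc : IsMaxChain (· ≤ ·) c) :
    ∃ a b : X, IsMin a ∧ IsMax b ∧ c.encard + f b = f a + 1 := by
  have hne : c.Nonempty := hc.nonempty_iff.mp inferInstance
  have cmp : ∀ {x y}, x ∈ c → y ∈ c → f y ≤ f x → x ≤ y := by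
    intro x y hx hy h
    rcases hc.1.total hx hy with h' | h'
    · exact h'
    · rcases h'.eq_or_lt with rfl | h'
      · exact le_rfl
      · exact absurd (hf h') (by omega)
  have hfin : (f '' c).Finite := (Set.finite_Iic N).subset fun _ ⟨x, _, h⟩ ↦ h ▸ hN x
  obtain ⟨_, ⟨a, ha, rfl⟩, ha'⟩ := hfin.exists_maximal (hne.image f)
  obtain ⟨_, ⟨b, hb, rfl⟩, hb'⟩ := hfin.exists_minimal (hne.image f)
  have hac : ∀ x ∈ c, a ≤ x := fun x hx ↦ cmp ha hx <| by
    have := ha' (Set.mem_image_of_mem f hx); omega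
  have hbc : ∀ x ∈ c, x ≤ b := fun x hx ↦ cmp hx hb <| by
    have := hb' (Set.mem_image_of_mem f hx); omega
  refine ⟨a, b, ?_, ?_, ?_⟩
  · intro z hz
    exact hac z (hc.mem_of_forall fun x hx ↦ .inl (hz.trans (hac x hx)))
  · intro z hz
    exact hbc z (hc.mem_of_forall fun x hx ↦ .inr ((hbc x hx).trans hz))
  have hinj : Set.InjOn f c := fun x hx y hy h ↦
    le_antisymm (cmp hx hy h.ge) (cmp hy hx h.le)
  have himg : f '' c = Set.Icc (f b) (f a) := by
    refine Set.Subset.antisymm ?_ ?_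
    · rintro _ ⟨x, hx, rfl⟩
      exact ⟨hf.antitone (hbc x hx), hf.antitone (hac x hx)⟩
    · intro n hn
      by_contra hnc
      have hne1 : (f '' c ∩ Set.Iic n).Nonempty := ⟨f b, ⟨b, hb, rfl⟩, hn.1⟩
      have hne2 : (f '' c ∩ Set.Ici n).Nonempty := ⟨f a, ⟨a, ha, rfl⟩, hn.2⟩
      obtain ⟨_, ⟨⟨y, hy, rfl⟩, hyn⟩, hy'⟩ := (hfin.inter_of_left _).exists_maximal hne1
      obtain ⟨_, ⟨⟨x, hx, rfl⟩, hxn⟩, hx'⟩ := (hfin.inter_of_left _).exists_minimal hne2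
      have hyn' : f y < n := lt_of_le_of_ne hyn fun h ↦ hnc ⟨y, hy, h⟩
      have hxn' : n < f x := lt_of_le_of_ne hxn fun h ↦ hnc ⟨x, hx, h.symm⟩
      -- `x` and `y` are the members with values nearest to the missing `n` on either side. An
      -- element strictly between them is comparable to the whole chain, hence belongs to it, and
      -- its value contradicts this choice.
      have key : x ⋖ y := by
        refine ⟨lt_of_le_of_ne (cmp hx hy (by omega)) fun h ↦ by subst h; omega, ?_⟩
        intro z hxz hzy
        have hz : z ∈ c := by
          refine hc.mem_of_forall fun w hw ↦ ?_
          rcases le_total (f w) n with h | h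
          · have := hy' ⟨⟨w, hw, rfl⟩, h⟩
            exact .inl (hzy.le.trans (cmp hy hw (by omega)))
          · have := hx' ⟨⟨w, hw, rfl⟩, h⟩
            exact .inr ((cmp hw hx (by omega)).trans hxz.le)
        have h1 := hf hxz
        have h2 := hf hzy
        rcases le_total (f z) n with h | h
        · have := hy' ⟨⟨z, hz, rfl⟩, h⟩
          omega
        · have := hx' ⟨⟨z, hz, rfl⟩, h⟩
          omega
      have := hcov x y key
      omega
  have hba : f b ≤ f a := hf.antitone (hac b hb)
  rw [← hinj.encard_image, himg, ← Finset.coe_Icc, Set.encard_coe_eq_coe_finsetCard, Nat.card_Icc]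
  exact_mod_cast (by omega : f a + 1 - f b + f b = f a + 1)

/-! ### Lengths over one-dimensional Noetherian domains -/

theorem Module.length_quotient_map_eq_add {B M P : Type*} [CommRing B] [AddCommGroup M]
    [Module B M] [AddCommGroup P] [Module B P] {φ : P →ₗ[B] M} (hφ : Function.Injective φ)
    (Q : Submodule B P) :
    Module.length B (M ⧸ Q.map φ) = Module.length B (P ⧸ Q) +
      Module.length B (M ⧸ LinearMap.range φ) := by
  have hle : Q.map φ ≤ LinearMap.range φ := LinearMap.map_le_range
  refine Module.length_eq_add_of_exact (Q.mapQ (Q.map φ) φ (Submodule.le_comap_map φ Q))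
    (Submodule.factor hle) ?_ (Submodule.factor_surjective hle) ?_
  · rw [← LinearMap.ker_eq_bot, Submodule.ker_mapQ, Submodule.comap_map_eq_of_injective hφ,
      Submodule.mkQ_map_self]
  · rw [LinearMap.exact_iff, Submodule.range_mapQ, Submodule.factor, Submodule.ker_mapQ]
    rfl

/-- `M` is a finite module over `B / (b)`, which is Artinian. -/
theorem Module.IsTorsionBy.isFiniteLength {B M : Type*} [CommRing B] [IsDomain B]
    [IsNoetherianRing B] [Ring.KrullDimLE 1 B] [AddCommGroup M] [Module B M] [Module.Finite B M]
    {b : B} (hb : b ≠ 0) (h : Module.IsTorsionBy B M b) : IsFiniteLength B M := by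
  have h1 := isFiniteLength_quotient_span_singleton B (mem_nonZeroDivisors_of_ne_zero hb)
  rw [isFiniteLength_iff_isNoetherian_isArtinian] at h1 ⊢
  have : IsArtinianRing (B ⧸ Ideal.span {b}) := by
    have := h1.2
    exact isArtinian_of_tower B this
  refine ⟨inferInstance, ?_⟩
  have h' : Module.IsTorsionBySet B M (Ideal.span {b} : Ideal B) :=
    (Module.isTorsionBySet_span_singleton_iff b).mpr h
  let := h'.module
  have : IsScalarTower B (B ⧸ Ideal.span {b}) M := h'.isScalarTower
  have : Module.Finite (B ⧸ Ideal.span {b}) M := Module.Finite.of_restrictScalars_finite B _ _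
  exact isArtinian_of_surjective_algebraMap (Ideal.Quotient.mk_surjective (I := Ideal.span {b}))

theorem Module.IsTorsion.exists_isTorsionBy {B M : Type*} [CommRing B] [IsDomain B]
    [AddCommGroup M] [Module B M] [Module.Finite B M] (h : Module.IsTorsion B M) :
    ∃ b : B, b ≠ 0 ∧ Module.IsTorsionBy B M b := by
  obtain ⟨b, hb, hb'⟩ := Submodule.annihilator_top_inter_nonZeroDivisors h
  exact ⟨b, nonZeroDivisors.ne_zero hb', fun x ↦ Submodule.mem_annihilator.mp hb x trivial⟩

theorem Module.length_quotient_pi_range_lsmul {B : Type*} [CommRing B] (r : ℕ) (x : B) :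
    Module.length B ((Fin r → B) ⧸ LinearMap.range (LinearMap.lsmul B (Fin r → B) x)) =
      r * Ring.ord B x := by
  have h : LinearMap.range (LinearMap.lsmul B (Fin r → B) x) =
      Submodule.pi Set.univ (fun _ : Fin r ↦ Ideal.span {x}) := by
    ext v
    simp only [LinearMap.mem_range, Submodule.mem_pi, Ideal.mem_span_singleton', Set.mem_univ,
      true_imp_iff]
    constructor
    · rintro ⟨w, rfl⟩ i
      exact ⟨w i, by simp [mul_comm]⟩
    · intro hv
      choose w hw using hv
      exact ⟨w, by ext i; simp [← hw i, mul_comm]⟩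
  rw [h, (Submodule.quotientPi (fun _ : Fin r ↦ Ideal.span {x})).length_eq,
    Module.length_pi_of_fintype]
  simp [Ring.ord]

/-- Over a one-dimensional Noetherian domain `B`, a finite torsion-free module `M` satisfies
`ℓ(M / xM) = rank M * ℓ(B / xB)`. -/
theorem Module.length_quotient_range_lsmul {B M : Type*} [CommRing B] [IsDomain B]
    [IsNoetherianRing B] [Ring.KrullDimLE 1 B] [AddCommGroup M] [Module B M] [Module.Finite B M]
    [Module.IsTorsionFree B M] {x : B} (hx : x ≠ 0) :
    Module.length B (M ⧸ (LinearMap.range (LinearMap.lsmul B M x))) =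
      Module.finrank B M * Ring.ord B x := by
  obtain ⟨v, hv⟩ : ∃ v : Fin (Module.finrank B M) → M, LinearIndependent B v :=
    exists_linearIndependent_of_le_finrank le_rfl
  let g : (Fin (Module.finrank B M) → B) →ₗ[B] M := Fintype.linearCombination B v
  have hg : Function.Injective g := linearIndependent_iff_injective_fintypeLinearCombination.mp hv
  have hx' : Function.Injective (LinearMap.lsmul B M x) := smul_right_injective M hx
  have htors : Module.IsTorsion B (M ⧸ LinearMap.range g) := by
    rw [← Module.finrank_eq_zero_iff_isTorsion]
    have h1 := Submodule.finrank_quotient_add_finrank (LinearMap.range g)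
    have h2 : Module.finrank B (LinearMap.range g) = Module.finrank B M := by
      rw [LinearMap.finrank_range_of_inj hg]; simp
    omega
  obtain ⟨b, hb, hbt⟩ := htors.exists_isTorsionBy
  have hfin : Module.length B (M ⧸ LinearMap.range g) ≠ ⊤ :=
    Module.length_ne_top_iff.mpr (hbt.isFiniteLength hb)
  -- With `G` the image of the free module, `ℓ(M / xG)` is computed through `xM` and through `G`;
  -- the finite term `ℓ(M / G)` then cancels.
  have e1 := Module.length_quotient_map_eq_add hx' (LinearMap.range g)
  have e2 := Module.length_quotient_map_eq_add hg
    (LinearMap.range (LinearMap.lsmul B (Fin (Module.finrank B M) → B) x))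
  have hcomm : (LinearMap.range (LinearMap.lsmul B (Fin (Module.finrank B M) → B) x)).map g =
      (LinearMap.range g).map (LinearMap.lsmul B M x) := by
    rw [← LinearMap.range_comp, ← LinearMap.range_comp]
    congr 1
    ext
    simp
  rw [hcomm, e1, add_comm, Module.length_quotient_pi_range_lsmul] at e2
  exact WithTop.add_right_cancel hfin e2

/-- Both sides are the length of `C / xC` over `B`: on the left as a quotient of a torsion-free
module, on the right by restricting scalars, which multiplies lengths by the residue degree. -/
theorem finrank_mul_ord {B C : Type*} [CommRing B] [IsDomain B] [IsLocalRing B]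
    [IsNoetherianRing B] [Ring.KrullDimLE 1 B] [CommRing C] [IsDomain C] [IsLocalRing C]
    [Algebra B C] [Module.Finite B C] [IsLocalHom (algebraMap B C)]
    (hinj : Function.Injective (algebraMap B C)) {x : B} (hx : x ≠ 0) :
    Module.finrank B C * Ring.ord B x = Ring.ord C (algebraMap B C x) *
      Module.length (IsLocalRing.ResidueField B) (IsLocalRing.ResidueField C) := by
  have : FaithfulSMul B C := (faithfulSMul_iff_algebraMap_injective B C).mpr hinj
  have : Module.IsTorsionFree B C := inferInstance
  rw [← Module.length_quotient_range_lsmul hx, Ring.ord, ← IsLocalRing.length_restrictScalars]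
  refine LinearEquiv.length_eq (Submodule.quotEquivOfEq _
    ((Ideal.span {algebraMap B C x}).restrictScalars B) ?_)
  ext y
  simp [Ideal.mem_span_singleton', Algebra.smul_def, mul_comm]

/-! ### Degrees of homomorphisms, and Frobenius in dimension one -/

/-- The degree of the extension of modules defined by a ring homomorphism. -/
noncomputable def RingHom.degree {A B : Type*} [CommRing A] [CommRing B] (f : A →+* B) : ℕ :=
  @Module.finrank A B _ _ f.toAlgebra.toModule

theorem RingHom.degree_algebraMap (A B : Type*) [CommRing A] [CommRing B] [i : Algebra A B] :
    (algebraMap A B).degree = Module.finrank A B := by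
  have : (algebraMap A B).toAlgebra = i := Algebra.algebra_ext _ _ fun _ ↦ rfl
  rw [RingHom.degree, this]

theorem frobeniusDegree_eq_degree (k : Type*) [Field k] (p : ℕ) [Fact p.Prime] [CharP k p]
    (e : ℕ) : frobeniusDegree k p e = (iterateFrobenius k p e).degree := rfl

theorem RingHom.degree_comp {k l m : Type*} [Field k] [Field l] [Field m] (f : k →+* l)
    (g : l →+* m) : (g.comp f).degree = f.degree * g.degree := by
  let := f.toAlgebra
  let := g.toAlgebra
  let := (g.comp f).toAlgebra
  have : IsScalarTower k l m := .of_algebraMap_eq' rfl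
  exact (Module.finrank_mul_finrank k l m).symm

theorem RingHom.Finite.degree_pos {k l : Type*} [Field k] [Field l] {f : k →+* l}
    (hf : f.Finite) : 0 < f.degree := by
  let := f.toAlgebra
  have : Module.Finite k l := hf
  exact Module.finrank_pos (R := k) (M := l)

/-- The maps are bundled so that `F` may be a Frobenius endomorphism, whose algebra structure would
clash with the identity one. -/
theorem RingHom.degree_mul_ord {B C K L : Type*} [CommRing B] [IsDomain B] [IsLocalRing B]
    [IsNoetherianRing B] [Ring.KrullDimLE 1 B] [CommRing C] [IsDomain C] [IsLocalRing C]
    [Field K] [Field L] [Algebra B K] [Algebra C L] [IsFractionRing B K] [IsFractionRing C L]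
    {F : B →+* C} (hF : F.Finite) (hinj : Function.Injective F) [IsLocalHom F]
    {FK : K →+* L} (hK : FK.comp (algebraMap B K) = (algebraMap C L).comp F)
    {x : B} (hx : x ≠ 0) :
    FK.degree * Ring.ord B x =
      Ring.ord C (F x) * (IsLocalRing.ResidueField.map F).degree := by
  let := F.toAlgebra
  let := FK.toAlgebra
  let := ((algebraMap C L).comp F).toAlgebra
  have : IsScalarTower B C L := .of_algebraMap_eq' rfl
  have : IsScalarTower B K L := .of_algebraMap_eq' hK.symm
  have : Module.Finite B C := hF
  have : IsLocalHom (algebraMap B C) := ‹IsLocalHom F›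
  have h1 : FK.degree = Module.finrank B C := IsFractionRing.finrank_eq B K C L
  have h2 : Module.length (IsLocalRing.ResidueField B) (IsLocalRing.ResidueField C) =
      ((IsLocalRing.ResidueField.map F).degree : ℕ∞) := by
    rw [Module.length_eq_finrank]
    have h : IsLocalRing.ResidueField.map F =
        algebraMap (IsLocalRing.ResidueField B) (IsLocalRing.ResidueField C) := by
      ext y
      obtain ⟨y, rfl⟩ := IsLocalRing.residue_surjective y
      rfl
    rw [h, RingHom.degree_algebraMap]
  rw [h1, ← h2]
  exact finrank_mul_ord hinj hx

/-- For Frobenius, `F x = x ^ p ^ e` has order `p ^ e * ord x`; since `x` is a nonzero nonunit, `ord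
x` is finite and nonzero, and cancels. -/
theorem frobeniusDegree_of_krullDimLE_one {B K : Type*} [CommRing B] [IsDomain B]
    [IsLocalRing B] [IsNoetherianRing B] [Ring.KrullDimLE 1 B] (hB : ¬ IsField B)
    [Field K] [Algebra B K] [IsFractionRing B K]
    (p : ℕ) [Fact p.Prime] [CharP B p] [CharP K p] [CharP (IsLocalRing.ResidueField B) p]
    {e : ℕ} (hF : (iterateFrobenius B p e).Finite) :
    frobeniusDegree K p e = p ^ e * frobeniusDegree (IsLocalRing.ResidueField B) p e := by
  obtain ⟨x, hxm, hx⟩ := Submodule.exists_mem_ne_zero_of_ne_bot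
    (mt IsLocalRing.isField_iff_maximalIdeal_eq.mpr hB)
  have : IsLocalHom (iterateFrobenius B p e) := ⟨fun a ha ↦ by
    rw [iterateFrobenius_def] at ha
    exact (isUnit_pow_iff (pow_ne_zero e (Fact.out : p.Prime).ne_zero)).mp ha⟩
  have hK : (iterateFrobenius K p e).comp (algebraMap B K) =
      (algebraMap B K).comp (iterateFrobenius B p e) := by
    ext; simp [iterateFrobenius_def]
  have hk : IsLocalRing.ResidueField.map (iterateFrobenius B p e) =
      iterateFrobenius (IsLocalRing.ResidueField B) p e := by
    ext y
    obtain ⟨y, rfl⟩ := IsLocalRing.residue_surjective y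
    simp [iterateFrobenius_def]
  have key := RingHom.degree_mul_ord hF (iterateFrobenius_inj B p e) hK hx
  have hxd := mem_nonZeroDivisors_of_ne_zero hx
  rw [hk, iterateFrobenius_def, Ring.ord_pow hxd, ← frobeniusDegree_eq_degree,
    ← frobeniusDegree_eq_degree] at key
  have htop := Ring.ord_ne_top hxd
  have hne : Ring.ord B x ≠ 0 := by
    rw [Ring.ord, Ne, Module.length_eq_zero_iff, Ideal.Quotient.subsingleton_iff,
      Ideal.span_singleton_eq_top]
    exact hxm
  obtain ⟨n, hn⟩ := ENat.ne_top_iff_exists.mp htop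
  rw [← hn] at key hne
  have hn0 : n ≠ 0 := by exact_mod_cast hne
  have key' : frobeniusDegree K p e * n =
      p ^ e * n * frobeniusDegree (IsLocalRing.ResidueField B) p e := by
    have := key
    rw [nsmul_eq_mul] at this
    exact_mod_cast this
  refine Nat.eq_of_mul_eq_mul_right (Nat.pos_of_ne_zero hn0) ?_
  rw [key']; ring

/-! ### Permanence of finiteness of Frobenius -/

theorem RingHom.charP_of_prime {S T : Type*} [CommRing S] [CommRing T] [Nontrivial T]
    (f : S →+* T) (p : ℕ) [Fact p.Prime] [CharP S p] : CharP T p := by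
  have h : ((p : ℕ) : T) = 0 := by
    rw [← map_natCast f p, CharP.cast_eq_zero, map_zero]
  exact (CharP.charP_iff_prime_eq_zero Fact.out).mpr h

theorem RingHom.Finite.iterateFrobenius {S T : Type*} [CommRing S] [CommRing T] {f : S →+* T}
    (hf : f.Finite) (p : ℕ) [Fact p.Prime] [CharP S p] [CharP T p] {e : ℕ}
    (hF : (iterateFrobenius S p e).Finite) : (_root_.iterateFrobenius T p e).Finite := by
  refine RingHom.Finite.of_comp_finite (f := f) ?_
  rw [← f.iterateFrobenius_comm]
  exact hf.comp hF

theorem IsFFinite.iterateFrobenius_finite {S : Type*} [CommRing S] {p : ℕ} [Fact p.Prime]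
    [CharP S p] (h : IsFFinite S p) (e : ℕ) : (iterateFrobenius S p e).Finite := by
  obtain ⟨n, hn, hF⟩ := h
  have h1 : (frobenius S p).Finite := by
    obtain ⟨m, rfl⟩ := Nat.exists_eq_succ_of_ne_zero hn.ne'
    refine RingHom.Finite.of_comp_finite (f := iterateFrobenius S p m) ?_
    rwa [← iterateFrobenius_one, ← iterateFrobenius_add, add_comm]
  induction e with
  | zero => rw [iterateFrobenius_zero]; exact RingHom.Finite.id S
  | succ m ih => rw [iterateFrobenius_add, iterateFrobenius_one]; exact ih.comp h1

theorem iterateFrobenius_finite_of_isLocalization {S T : Type u} [CommRing S] [CommRing T]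
    [Algebra S T] (M : Submonoid S) [IsLocalization M T] (p : ℕ) [Fact p.Prime] [CharP S p]
    [CharP T p] {e : ℕ} (hF : (iterateFrobenius S p e).Finite) :
    (iterateFrobenius T p e).Finite := by
  have hpe : p ^ e ≠ 0 := pow_ne_zero e (Fact.out : p.Prime).ne_zero
  obtain ⟨n, hn⟩ := Nat.exists_eq_succ_of_ne_zero hpe
  -- Inverting the `p ^ e`-th powers of `M` already inverts `M`, because `a / s = a * s ^ n / s ^ (n
  -- + 1)` with `n + 1 = p ^ e`. So Frobenius on `T` is a localization of Frobenius on `S`.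
  have : IsLocalization (M.map (iterateFrobenius S p e)) T :=
    { map_units := by
        rintro ⟨_, m, hm, rfl⟩
        simp only [iterateFrobenius_def, map_pow]
        exact (IsLocalization.map_units T ⟨m, hm⟩).pow _
      surj := fun z ↦ by
        obtain ⟨⟨a, s⟩, h⟩ := IsLocalization.surj M z
        refine ⟨⟨a * s ^ n, ⟨_, s, s.2, rfl⟩⟩, ?_⟩
        simp only [iterateFrobenius_def, map_pow, map_mul, hn, pow_succ'] at h ⊢
        rw [← h, mul_assoc]
      exists_of_eq := fun {x y} h ↦ by
        obtain ⟨s, hs⟩ := (IsLocalization.eq_iff_exists M T).mp h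
        refine ⟨⟨_, s, s.2, rfl⟩, ?_⟩
        simp only [iterateFrobenius_def, hn, pow_succ]
        rw [mul_assoc, hs, mul_assoc] }
  have h := RingHom.finite_localizationPreserves (iterateFrobenius S p e) M T T hF
  convert h
  refine IsLocalization.ringHom_ext M ?_
  rw [IsLocalization.map_comp]
  exact ((algebraMap S T).iterateFrobenius_comm p e).symm

/-! ### Degrees of Frobenius on residue fields -/

/-- Since `f` commutes with Frobenius, multiplicativity of degrees gives two products sharing the
factor `[l : k]`, which is finite and nonzero. -/
theorem frobeniusDegree_eq_of_finite {k l : Type*} [Field k] [Field l] {f : k →+* l}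
    (hf : f.Finite) (p : ℕ) [Fact p.Prime] [CharP k p] [CharP l p] (e : ℕ) :
    frobeniusDegree k p e = frobeniusDegree l p e := by
  have h := congrArg RingHom.degree (f.iterateFrobenius_comm p e)
  rw [RingHom.degree_comp, RingHom.degree_comp, mul_comm] at h
  exact Nat.eq_of_mul_eq_mul_left hf.degree_pos h

/-- Any field generated by fractions of the image of `S` serves as a model of `κ(q)`: the induced
map from `κ(q)` is surjective, hence finite. -/
theorem residueDegree_eq_frobeniusDegree {S L : Type*} [CommRing S] [Field L] (p : ℕ)
    [Fact p.Prime] [CharP S p] [CharP L p] (e : ℕ) {φ : S →+* L}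
    (hφ : ∀ y, ∃ a b, φ b ≠ 0 ∧ y * φ b = φ a) {q : PrimeSpectrum S}
    (hq : RingHom.ker φ = q.asIdeal) : residueDegree p e q = frobeniusDegree L p e := by
  have := charP_residueField p q
  have hu : q.asIdeal.primeCompl ≤ (IsUnit.submonoid L).comap φ := fun x hx ↦
    isUnit_iff_ne_zero.mpr fun h ↦ hx (hq ▸ h)
  refine frobeniusDegree_eq_of_finite
    (f := Ideal.ResidueField.lift q.asIdeal φ hq.ge hu) (.of_surjective _ fun y ↦ ?_) p e
  obtain ⟨a, b, hb, h⟩ := hφ y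
  refine ⟨algebraMap S _ a / algebraMap S _ b, ?_⟩
  rw [map_div₀, Ideal.ResidueField.lift_algebraMap, Ideal.ResidueField.lift_algebraMap,
    div_eq_iff hb, h]

theorem residueDegree_bot {S K : Type*} [CommRing S] [IsDomain S] [Field K] [Algebra S K]
    [IsFractionRing S K] (p : ℕ) [Fact p.Prime] [CharP S p] [CharP K p] (e : ℕ) :
    residueDegree p e (⊥ : PrimeSpectrum S) = frobeniusDegree K p e := by
  refine residueDegree_eq_frobeniusDegree p e (φ := algebraMap S K) (fun y ↦ ?_)
    ((RingHom.injective_iff_ker_eq_bot _).mp (IsFractionRing.injective S K))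
  obtain ⟨⟨a, b⟩, h⟩ := IsLocalization.surj (nonZeroDivisors S) y
  exact ⟨a, b, (IsLocalization.map_units K b).ne_zero, h⟩

/-- As `finrank` is `0` in infinite dimension, positivity expresses finiteness of the degree. -/
theorem residueDegree_pos {S : Type*} [CommRing S] (p : ℕ) [Fact p.Prime] [CharP S p] {e : ℕ}
    (hF : (iterateFrobenius S p e).Finite) (q : PrimeSpectrum S) : 0 < residueDegree p e q := by
  have := charP_residueField p q
  have := (Ideal.Quotient.mk q.asIdeal).charP_of_prime p
  have h1 : (iterateFrobenius (S ⧸ q.asIdeal) p e).Finite :=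
    (RingHom.Finite.of_surjective _ Ideal.Quotient.mk_surjective).iterateFrobenius p hF
  exact (iterateFrobenius_finite_of_isLocalization (T := q.asIdeal.ResidueField)
    (nonZeroDivisors (S ⧸ q.asIdeal)) p h1).degree_pos

theorem residueDegree_comap {A R : Type*} [CommRing A] [CommRing R] [Algebra A R]
    [Module.Finite A R] (p : ℕ) [Fact p.Prime] [CharP A p] [CharP R p] (e : ℕ)
    (q : PrimeSpectrum R) :
    residueDegree p e (q.comap (algebraMap A R)) = residueDegree p e q := by
  have := charP_residueField p q
  have := charP_residueField p (q.comap (algebraMap A R))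
  let f : (q.comap (algebraMap A R)).asIdeal.ResidueField →+* q.asIdeal.ResidueField :=
    Ideal.ResidueField.map _ _ (algebraMap A R) rfl
  refine frobeniusDegree_eq_of_finite (f := f) ?_ p e
  let := f.toAlgebra
  have : IsScalarTower A (q.comap (algebraMap A R)).asIdeal.ResidueField q.asIdeal.ResidueField :=
    .of_algebraMap_eq fun a ↦ by
      change _ = f _
      rw [IsScalarTower.algebraMap_apply A R]
      exact (Ideal.ResidueField.map_algebraMap _ _ _ _ a).symm
  have : Algebra.QuasiFinite (q.comap (algebraMap A R)).asIdeal.ResidueField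
      q.asIdeal.ResidueField := .of_restrictScalars A _ _
  have h : Module.Finite (q.comap (algebraMap A R)).asIdeal.ResidueField
      q.asIdeal.ResidueField := .of_quasiFinite
  exact h

theorem residueDegree_eq_mul_of_krullDimLE_one {S B : Type*} [CommRing S] [CommRing B] [IsDomain B]
    [IsLocalRing B] [IsNoetherianRing B] [Ring.KrullDimLE 1 B] (hB : ¬ IsField B) (p : ℕ)
    [Fact p.Prime] [CharP S p] [CharP B p] {e : ℕ} (hFB : (iterateFrobenius B p e).Finite)
    {φ : S →+* B} (hφfrac : ∀ y : B, ∃ a b, IsUnit (φ b) ∧ y * φ b = φ a)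
    {q q' : PrimeSpectrum S} (hφker : RingHom.ker φ = q.asIdeal)
    (hφmax : (IsLocalRing.maximalIdeal B).comap φ = q'.asIdeal) :
    residueDegree p e q = p ^ e * residueDegree p e q' := by
  have := (IsLocalRing.residue B).charP_of_prime p
  have := (algebraMap B (FractionRing B)).charP_of_prime p
  have key := frobeniusDegree_of_krullDimLE_one (K := FractionRing B) hB p hFB
  have h1 : residueDegree p e q = frobeniusDegree (FractionRing B) p e := by
    refine residueDegree_eq_frobeniusDegree p e (φ := (algebraMap B (FractionRing B)).comp φ)
      (fun y ↦ ?_) ?_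
    · obtain ⟨⟨a, b⟩, h⟩ := IsLocalization.surj (nonZeroDivisors B) y
      obtain ⟨a1, a2, ha2, ha⟩ := hφfrac a
      obtain ⟨b1, b2, hb2, hb⟩ := hφfrac b
      have hbne := (IsLocalization.map_units (FractionRing B) b).ne_zero
      refine ⟨a1 * b2, b1 * a2, ?_, ?_⟩
      · simp only [RingHom.comp_apply, map_mul, ← hb]
        exact mul_ne_zero (mul_ne_zero hbne (hb2.map _).ne_zero) (ha2.map _).ne_zero
      · simp only [RingHom.comp_apply, map_mul, ← hb, ← ha] at h ⊢
        rw [← h]; ring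
    · rw [← RingHom.comap_ker, (RingHom.injective_iff_ker_eq_bot _).mp
        (IsFractionRing.injective B (FractionRing B))]
      exact hφker
  have h2 : residueDegree p e q' = frobeniusDegree (IsLocalRing.ResidueField B) p e := by
    refine residueDegree_eq_frobeniusDegree p e (φ := (IsLocalRing.residue B).comp φ)
      (fun y ↦ ?_) ?_
    · obtain ⟨y, rfl⟩ := IsLocalRing.residue_surjective y
      obtain ⟨a, b, hb, h⟩ := hφfrac y
      exact ⟨a, b, (hb.map (IsLocalRing.residue B)).ne_zero, by simp only [RingHom.comp_apply, ← h, map_mul]⟩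
    · rw [← RingHom.comap_ker, IsLocalRing.ker_residue]
      exact hφmax
  rw [h1, h2, key]

/-- The primes of `B = (S/q)_{q'}` correspond to those between `q` and `q'`; the covering relation
leaves only these two, so `B` has dimension one, with `κ(q)` and `κ(q')` as fraction and residue
field. -/
theorem residueDegree_of_covBy {S : Type*} [CommRing S] [IsNoetherianRing S] (p : ℕ)
    [Fact p.Prime] [CharP S p] {e : ℕ} (hF : (iterateFrobenius S p e).Finite)
    {q q' : PrimeSpectrum S} (hqq' : q ⋖ q') :
    residueDegree p e q = p ^ e * residueDegree p e q' := by
  let D := S ⧸ q.asIdeal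
  have hsurj : Function.Surjective (Ideal.Quotient.mk q.asIdeal) := Ideal.Quotient.mk_surjective
  let P : Ideal D := q'.asIdeal.map (Ideal.Quotient.mk q.asIdeal)
  have hker : RingHom.ker (Ideal.Quotient.mk q.asIdeal) ≤ q'.asIdeal := by
    rw [Ideal.mk_ker]; exact hqq'.le
  have hP : P.IsPrime := Ideal.map_isPrime_of_surjective hsurj hker
  have hPq : P.comap (Ideal.Quotient.mk q.asIdeal) = q'.asIdeal := by
    rw [Ideal.comap_map_of_surjective' _ hsurj]
    exact sup_eq_left.mpr hker
  let B := Localization.AtPrime P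
  have : IsNoetherianRing B := IsLocalization.isNoetherianRing P.primeCompl B inferInstance
  have : IsDomain B := IsLocalization.isDomain_localization P.primeCompl_le_nonZeroDivisors
  let φ : S →+* B := (algebraMap D B).comp (Ideal.Quotient.mk q.asIdeal)
  have hDB : Function.Injective (algebraMap D B) :=
    IsLocalization.injective B P.primeCompl_le_nonZeroDivisors
  have hφker : RingHom.ker φ = q.asIdeal := by
    ext s
    rw [RingHom.mem_ker, RingHom.comp_apply, map_eq_zero_iff _ hDB, Ideal.Quotient.eq_zero_iff_mem]
  have hφfrac : ∀ y : B, ∃ a b, IsUnit (φ b) ∧ y * φ b = φ a := by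
    intro y
    obtain ⟨⟨a, b⟩, h⟩ := IsLocalization.surj P.primeCompl y
    obtain ⟨a', ha'⟩ := hsurj a
    obtain ⟨b', hb'⟩ := hsurj b
    refine ⟨a', b', ?_, ?_⟩
    · simpa only [φ, RingHom.comp_apply, hb'] using IsLocalization.map_units B b
    · simpa only [φ, RingHom.comp_apply, hb', ha'] using h
  have hφmax : (IsLocalRing.maximalIdeal B).comap φ = q'.asIdeal := by
    rw [← Ideal.comap_comap, ← hPq]
    congr 1
    exact IsLocalization.AtPrime.under_maximalIdeal B P
  have hinj : Function.Injective (PrimeSpectrum.comap φ) := by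
    rw [PrimeSpectrum.comap_comp]
    exact (PrimeSpectrum.comap_injective_of_surjective _ hsurj).comp
      (PrimeSpectrum.localization_comap_injective B P.primeCompl)
  have hcl : PrimeSpectrum.comap φ (IsLocalRing.closedPoint B) = q' := PrimeSpectrum.ext hφmax
  have hbot : PrimeSpectrum.comap φ ⊥ = q := PrimeSpectrum.ext hφker
  have : Ring.KrullDimLE 1 B := by
    rw [Ring.krullDimLE_one_iff_of_noZeroDivisors]
    intro I hI hIp
    let y : PrimeSpectrum B := ⟨I, hIp⟩
    have hy1 : q ≤ PrimeSpectrum.comap φ y := 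
      hbot.ge.trans (Ideal.comap_mono (f := φ) (bot_le : ⊥ ≤ I))
    have hy2 : PrimeSpectrum.comap φ y ≤ q' :=
      (Ideal.comap_mono (f := φ) (IsLocalRing.le_maximalIdeal hIp.ne_top)).trans hcl.le
    rcases hqq'.wcovBy.eq_or_eq hy1 hy2 with h | h
    · exact absurd (congrArg PrimeSpectrum.asIdeal (hinj (h.trans hbot.symm))) hI
    · have : I = IsLocalRing.maximalIdeal B :=
        congrArg PrimeSpectrum.asIdeal (hinj (h.trans hcl.symm))
      rw [this]
      exact IsLocalRing.maximalIdeal.isMaximal B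
  have hB : ¬ IsField B := by
    intro h
    rw [IsLocalRing.isField_iff_maximalIdeal_eq] at h
    have : IsLocalRing.closedPoint B = ⊥ := PrimeSpectrum.ext h
    rw [this, hbot] at hcl
    exact hqq'.ne hcl
  have := (Ideal.Quotient.mk q.asIdeal).charP_of_prime p
  have := φ.charP_of_prime p
  have hFD : (iterateFrobenius D p e).Finite :=
    (RingHom.Finite.of_surjective _ hsurj).iterateFrobenius p hF
  have hFB : (iterateFrobenius B p e).Finite :=
    iterateFrobenius_finite_of_isLocalization P.primeCompl p hFD
  exact residueDegree_eq_mul_of_krullDimLE_one hB p hFB hφfrac hφker hφmax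

/-! ### Dimension conditions in terms of the order on primes -/

namespace PrimeSpectrum

variable {S : Type*} [CommRing S]

theorem ringKrullDim_quotient_eq_coheight (P : PrimeSpectrum S) :
    ringKrullDim (S ⧸ P.asIdeal) = Order.coheight P := by
  rw [ringKrullDim_quotient, Order.coheight_eq_krullDim_Ici]
  rfl

theorem ringKrullDim_localization_eq_height (q : PrimeSpectrum S) :
    ringKrullDim (Localization.AtPrime q.asIdeal) = Order.height q := by
  rw [IsLocalization.AtPrime.ringKrullDim_eq_height q.asIdeal, PrimeSpectrum.height_eq_orderHeight]

theorem exists_isMin_le (q : PrimeSpectrum S) : ∃ P : PrimeSpectrum S, IsMin P ∧ P ≤ q := by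
  obtain ⟨P, hP, hPq⟩ := Ideal.exists_minimalPrimes_le (I := ⊥) (J := q.asIdeal) bot_le
  exact ⟨⟨P, hP.1.1⟩, PrimeSpectrum.isMin_iff.mpr hP, hPq⟩

theorem topologicalKrullDim_zeroLocus (I : Ideal S) :
    topologicalKrullDim (zeroLocus (I : Set S)) = ringKrullDim (S ⧸ I) := by
  rw [ringKrullDim_quotient, topologicalKrullDim, ← Order.krullDim_orderDual]
  exact (Order.krullDim_eq_of_orderIso (PrimeSpectrum.zeroLocusEquivIrreducibleCloseds (I : Set S))).symm

end PrimeSpectrum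

open PrimeSpectrum

theorem isEquidimensionalRing_iff {S : Type*} [CommRing S] :
    IsEquidimensionalRing S ↔ ∀ P P' : PrimeSpectrum S, IsMin P → IsMin P' →
      Order.coheight P = Order.coheight P' := by
  have key : ∀ P : PrimeSpectrum S, topologicalKrullDim (zeroLocus (P.asIdeal : Set S)) =
      (Order.coheight P : WithBot ℕ∞) := fun P ↦ by
    rw [topologicalKrullDim_zeroLocus, ringKrullDim_quotient_eq_coheight]
  rw [IsEquidimensionalRing, IsEquidimensionalSpace, ← zeroLocus_minimalPrimes]
  constructor
  · intro h P P' hP hP'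
    have := h _ (Set.mem_image_of_mem _ (PrimeSpectrum.isMin_iff.mp hP)) _
      (Set.mem_image_of_mem _ (PrimeSpectrum.isMin_iff.mp hP'))
    simp only [Function.comp_apply] at this
    rw [key, key] at this
    exact_mod_cast this
  · rintro h _ ⟨P, hP, rfl⟩ _ ⟨P', hP', rfl⟩
    have := h ⟨P, hP.1.1⟩ ⟨P', hP'.1.1⟩ (PrimeSpectrum.isMin_iff.mpr hP)
      (PrimeSpectrum.isMin_iff.mpr hP')
    exact (key ⟨P, hP.1.1⟩).trans ((congrArg _ this).trans (key ⟨P', hP'.1.1⟩).symm)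

theorem IsLocallyEquidimensionalRing.coheight_eq {S : Type*} [CommRing S]
    (h : IsLocallyEquidimensionalRing S) (q : PrimeSpectrum S) (P P' : Set.Iic q)
    (hP : IsMin P) (hP' : IsMin P') : Order.coheight P = Order.coheight P' := by
  let ε := IsLocalization.AtPrime.primeSpectrumOrderIso (Localization.AtPrime q.asIdeal) q.asIdeal
  have := isEquidimensionalRing_iff.mp (h q) (ε.symm P) (ε.symm P')
    (ε.symm.isMin_apply.mpr hP) (ε.symm.isMin_apply.mpr hP')
  rwa [Order.coheight_orderIso, Order.coheight_orderIso] at this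

/-- Passing from closed sets to primes reverses the order, so minimal closed sets become maximal
ideals and codimension becomes height. -/
theorem IsEquicodimensionalRing.height_eq {S : Type*} [CommRing S]
    (h : IsEquicodimensionalRing S) {m m' : PrimeSpectrum S} (hm : IsMax m) (hm' : IsMax m') :
    Order.height m = Order.height m' := by
  let ε := PrimeSpectrum.pointsEquivIrreducibleCloseds S
  have := h (OrderDual.ofDual (ε m)) (OrderDual.ofDual (ε m'))
    (ε.isMax_apply.mpr hm).ofDual (ε.isMax_apply.mpr hm').ofDual
  rwa [Order.coheight_ofDual, Order.coheight_ofDual, Order.height_orderIso,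
    Order.height_orderIso] at this

theorem isBiequidimensionalRing_of_forall {S : Type*} [CommRing S] {n : ℕ∞}
    (h : ∀ c : Set (PrimeSpectrum S), IsMaxChain (· ≤ ·) c → c.encard = n) :
    IsBiequidimensionalRing S := by
  let ε := PrimeSpectrum.pointsEquivIrreducibleCloseds S
  have key : ∀ c : Set (IrreducibleCloseds (PrimeSpectrum S)), IsMaxChain (· ≤ ·) c →
      c.encard = n := by
    intro c hc
    let r : ((· ≤ ·) : IrreducibleCloseds (PrimeSpectrum S) → _ → Prop) ≃r
        (flip (· ≤ ·) : PrimeSpectrum S → PrimeSpectrum S → Prop) :=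
      ⟨(OrderDual.toDual).trans ε.symm.toEquiv, fun {a b} ↦ ε.symm.le_iff_le⟩
    have := h _ (hc.image r).symm
    rwa [r.injective.encard_image] at this
  intro c c' hc hc'
  rw [key c hc, key c' hc']

theorem natKrullDim_eq {S : Type*} [CommRing S] {n : ℕ} (h : ringKrullDim S = n) :
    natKrullDim S = n := by
  rw [natKrullDim, h]
  rfl

/-- Primes of a Noetherian ring have finite height. With the ascending chain condition, this
supplies the inductions and the covering elements required by the order lemmas. -/
instance PrimeSpectrum.instWellFoundedLT {S : Type*} [CommRing S] [IsNoetherianRing S] :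
    WellFoundedLT (PrimeSpectrum S) := by
  have h : StrictMono (Order.height : PrimeSpectrum S → ℕ∞) := fun x y hxy ↦
    Order.height_strictMono hxy (by
      rw [← PrimeSpectrum.height_eq_orderHeight]; exact Ideal.height_lt_top_of_isPrime)
  exact h.wellFoundedLT

instance PrimeSpectrum.instWellFoundedGT {S : Type*} [CommRing S] [IsNoetherianRing S] :
    WellFoundedGT (PrimeSpectrum S) :=
  StrictMono.wellFoundedGT (f := PrimeSpectrum.asIdeal) fun _ _ h ↦ h

/-! ### The residue rank of an `F`-finite Noetherian ring -/

/-- A single `n` serves both functions; this links the rank, defined with `e = 1`, to the degrees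
for arbitrary `e`. -/
theorem exists_eq_pow_mul_of_le {X : Type*} [PartialOrder X] [IsStronglyCoatomic X]
    [WellFoundedLT X] {f g : X → ℕ} {b : ℕ} (hf : ∀ x y, x ⋖ y → f x = f y + 1)
    (hg : ∀ x y, x ⋖ y → g x = b * g y) {x y : X} (hxy : x ≤ y) :
    ∃ n, f x = f y + n ∧ g x = b ^ n * g y := by
  induction y using WellFoundedLT.induction with
  | ind y ih =>
    rcases hxy.eq_or_lt with rfl | hlt
    · exact ⟨0, by simp⟩
    obtain ⟨z, hxz, hzy⟩ := exists_le_covBy_of_lt hlt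
    obtain ⟨n, h1, h2⟩ := ih z hzy.lt hxz
    refine ⟨n + 1, by rw [h1, hf z y hzy]; ring, by rw [h2, hg z y hzy]; ring⟩

/-- The exponent of `p` in `[κ(q)^{1/p} : κ(q)]`: a rank function on the spectrum of an `F`-finite
Noetherian ring, for the reversed order. -/
noncomputable def residueRank {S : Type*} [CommRing S] (p : ℕ) [Fact p.Prime] [CharP S p]
    (q : PrimeSpectrum S) : ℕ :=
  padicValNat p (residueDegree p 1 q)

section

variable {S : Type*} [CommRing S] [IsNoetherianRing S] {p : ℕ} [Fact p.Prime] [CharP S p]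

theorem IsFFinite.residueRank_of_covBy (hS : IsFFinite S p) (x y : PrimeSpectrum S)
    (h : x ⋖ y) : residueRank p x = residueRank p y + 1 := by
  have hF := hS.iterateFrobenius_finite 1
  rw [residueRank, residueDegree_of_covBy p hF h, pow_one,
    padicValNat.mul (Fact.out : p.Prime).ne_zero (residueDegree_pos p hF y).ne',
    padicValNat_self, add_comm, residueRank]

theorem IsFFinite.residueRank_strictAnti (hS : IsFFinite S p) :
    StrictAnti (residueRank (S := S) p) :=
  Order.strictAnti_of_covBy fun x y h ↦ by rw [hS.residueRank_of_covBy x y h]; omega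

theorem IsFFinite.exists_residueDegree_eq (hS : IsFFinite S p) (e : ℕ) {x y : PrimeSpectrum S}
    (h : x ≤ y) : ∃ n, residueRank p x = residueRank p y + n ∧
      residueDegree p e x = p ^ (e * n) * residueDegree p e y := by
  obtain ⟨n, h1, h2⟩ := exists_eq_pow_mul_of_le hS.residueRank_of_covBy
    (fun x y h ↦ residueDegree_of_covBy p (hS.iterateFrobenius_finite e) h) h
  exact ⟨n, h1, by rw [h2, pow_mul]⟩

theorem IsFFinite.height_add_residueRank (hS : IsFFinite S p) {q : PrimeSpectrum S} {c : ℕ}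
    (hc : ∀ P : PrimeSpectrum S, IsMin P → P ≤ q → residueRank p P = c) :
    Order.height q + residueRank p q = c :=
  Order.height_add_eq hS.residueRank_strictAnti hS.residueRank_of_covBy q hc

theorem IsFFinite.coheight_add_eq (hS : IsFFinite S p) {c : ℕ}
    (hc : ∀ m : PrimeSpectrum S, IsMax m → residueRank p m = c) (q : PrimeSpectrum S) :
    Order.coheight q + c = residueRank p q :=
  Order.coheight_add_eq hS.residueRank_strictAnti hS.residueRank_of_covBy q fun z hz _ ↦ hc z hz

/-- If all minimal primes below `q` have the same residue rank, then
`[κ(q)^{1/p^e} : κ(q)] * p ^ (e * dim S_q) = [κ(P)^{1/p^e} : κ(P)]` for all these minimal primes. -/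
theorem IsFFinite.kunzFunction_eq (hS : IsFFinite S p) (e : ℕ) {P q : PrimeSpectrum S} {c : ℕ}
    (hc : ∀ P : PrimeSpectrum S, IsMin P → P ≤ q → residueRank p P = c) (hP : IsMin P)
    (hPq : P ≤ q) : kunzFunction p e q = residueDegree p e P := by
  obtain ⟨n, h1, h2⟩ := hS.exists_residueDegree_eq e hPq
  have h := hS.height_add_residueRank hc
  rw [← hc P hP hPq, h1, add_comm, Nat.cast_add] at h
  have hn : Order.height q = n := WithTop.add_left_cancel (WithTop.natCast_ne_top _) h
  have hd : ringKrullDim (Localization.AtPrime q.asIdeal) = n := by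
    rw [PrimeSpectrum.ringKrullDim_localization_eq_height, hn]; rfl
  rw [kunzFunction, natKrullDim_eq hd, h2, mul_comm]

/-- In `Set.Iic q`, the spectrum of `S_q`, the only maximal element is `q`, so the coheight of `x`
is its rank minus that of `q`; local equidimensionality equates the coheights of minimal primes. -/
theorem IsFFinite.residueRank_eq_of_locallyEquidimensional (hS : IsFFinite S p)
    (h : IsLocallyEquidimensionalRing S) {q P P' : PrimeSpectrum S} (hP : IsMin P)
    (hPq : P ≤ q) (hP' : IsMin P') (hPq' : P' ≤ q) : residueRank p P = residueRank p P' := by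
  have key : ∀ x : Set.Iic q, Order.coheight x + residueRank p q = residueRank p x.1 := by
    intro x
    have hr : StrictAnti fun x : Set.Iic q ↦ residueRank p x.1 :=
      fun _ _ h ↦ hS.residueRank_strictAnti h
    refine Order.coheight_add_eq hr (fun y z hyz ↦ ?_) x fun z hz _ ↦ ?_
    · refine hS.residueRank_of_covBy _ _ ?_
      exact (Set.OrdConnected.apply_covBy_apply_iff (OrderEmbedding.subtype (· ∈ Set.Iic q))
        (by simpa using! Set.ordConnected_Iic)).mpr hyz
    · have : z = ⟨q, Set.self_mem_Iic⟩ := le_antisymm z.2 (hz z.2)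
      rw [this]
  have hmin : ∀ (P : PrimeSpectrum S) (hP : IsMin P) (hPq : P ≤ q),
      IsMin (⟨P, hPq⟩ : Set.Iic q) := fun P hP hPq y hy ↦ hP hy
  have := h.coheight_eq q ⟨P, hPq⟩ ⟨P', hPq'⟩ (hmin P hP hPq) (hmin P' hP' hPq')
  have h1 := key ⟨P, hPq⟩
  have h2 := key ⟨P', hPq'⟩
  rw [this, h2] at h1
  exact_mod_cast h1.symm

theorem IsFFinite.isBiequidimensionalRing [Nontrivial S] (hS : IsFFinite S p) {N c : ℕ}
    (hN : ∀ P : PrimeSpectrum S, IsMin P → residueRank p P = N)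
    (hc : ∀ m : PrimeSpectrum S, IsMax m → residueRank p m = c) : IsBiequidimensionalRing S := by
  -- A maximal chain takes each rank from `N` down to `c` once; the subtraction is not truncated,
  -- since `c ≤ N`.
  refine isBiequidimensionalRing_of_forall (n := (N + 1 - c : ℕ)) fun C hC ↦ ?_
  have hbd : ∀ x : PrimeSpectrum S, residueRank p x ≤ N := fun x ↦ by
    obtain ⟨P, hP, hPx⟩ := PrimeSpectrum.exists_isMin_le x
    exact hN P hP ▸ hS.residueRank_strictAnti.antitone hPx
  obtain ⟨a, b, ha, hb, h⟩ := hC.exists_encard_eq hS.residueRank_strictAnti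
    hS.residueRank_of_covBy hbd
  rw [hN a ha, hc b hb] at h
  have hcN : c ≤ N := hc b hb ▸ hbd b
  have h' : C.encard + c = ((N + 1 - c : ℕ) : ℕ∞) + (c : ℕ∞) := by
    rw [h]
    exact_mod_cast (by omega : N + 1 = N + 1 - c + c)
  exact WithTop.add_right_cancel (ENat.natCast_ne_top c) h'

end

/-! ### Finite extensions of an `F`-finite domain -/

section

variable {A R : Type*} [CommRing A] [CommRing R] [Algebra A R]

theorem PrimeSpectrum.comap_strictMono_of_isIntegral [Algebra.IsIntegral A R] :
    StrictMono (PrimeSpectrum.comap (algebraMap A R)) :=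
  fun _ _ h ↦ Ideal.IsIntegral.comap_lt_comap h

/-- Incomparability keeps chains strict under contraction, and going up lifts strict chains starting
at the contraction of `P`. -/
theorem PrimeSpectrum.coheight_comap [Algebra.IsIntegral A R] (P : PrimeSpectrum R) :
    Order.coheight (P.comap (algebraMap A R)) = Order.coheight P := by
  refine (Order.coheight_eq_of_strictMono _ comap_strictMono_of_isIntegral
    (fun a b hab ↦ ?_) P).symm
  obtain ⟨Q, hQ, hQp, hQb⟩ := Ideal.exists_ideal_over_prime_of_isIntegral_of_isPrime
    b.asIdeal a.asIdeal hab.le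
  have hb : PrimeSpectrum.comap (algebraMap A R) ⟨Q, hQp⟩ = b := PrimeSpectrum.ext hQb
  refine ⟨⟨Q, hQp⟩, lt_of_le_of_ne hQ ?_, hb⟩
  rintro rfl
  exact hab.ne hb

theorem PrimeSpectrum.exists_isMin_comap_eq_bot [IsDomain A] [Algebra.IsIntegral A R]
    (hAR : Function.Injective (algebraMap A R)) :
    ∃ P : PrimeSpectrum R, IsMin P ∧ P.comap (algebraMap A R) = ⊥ := by
  obtain ⟨Q, -, hQ, hQb⟩ := Ideal.exists_ideal_over_prime_of_isIntegral (S := R) (⊥ : Ideal A) ⊥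
    (((RingHom.injective_iff_ker_eq_bot _).mp hAR).le)
  obtain ⟨P, hP, hPQ⟩ := exists_isMin_le ⟨Q, hQ⟩
  refine ⟨P, hP, le_bot_iff.mp ?_⟩
  exact (Ideal.comap_mono hPQ).trans hQb.le

theorem ringKrullDim_eq_of_isIntegral [IsDomain A] [Algebra.IsIntegral A R]
    (hAR : Function.Injective (algebraMap A R)) :
    ringKrullDim R = Order.coheight (⊥ : PrimeSpectrum A) := by
  obtain ⟨P, -, hP⟩ := PrimeSpectrum.exists_isMin_comap_eq_bot hAR
  have : Nonempty (PrimeSpectrum R) := ⟨P⟩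
  rw [ringKrullDim, Order.krullDim_eq_iSup_coheight_of_nonempty, WithBot.coe_inj]
  refine le_antisymm (iSup_le fun Q ↦ ?_) (le_iSup_of_le P ?_)
  · rw [← PrimeSpectrum.coheight_comap (A := A)]
    exact Order.coheight_anti bot_le
  · rw [← PrimeSpectrum.coheight_comap (A := A) P, hP]

theorem residueRank_comap [Module.Finite A R] (p : ℕ) [Fact p.Prime] [CharP A p] [CharP R p]
    (q : PrimeSpectrum R) : residueRank p (q.comap (algebraMap A R)) = residueRank p q := by
  rw [residueRank, residueDegree_comap, residueRank]

theorem IsFFinite.of_finite [Module.Finite A R] {p : ℕ} [Fact p.Prime] [CharP A p] [CharP R p]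
    (h : IsFFinite A p) : IsFFinite R p :=
  ⟨1, one_pos, (RingHom.finite_algebraMap.mpr ‹Module.Finite A R›).iterateFrobenius p
    (h.iterateFrobenius_finite 1)⟩

theorem PrimeSpectrum.isMax_comap [Algebra.IsIntegral A R] {m : PrimeSpectrum R}
    (hm : IsMax m) : IsMax (m.comap (algebraMap A R)) := by
  rw [← Order.coheight_eq_zero, coheight_comap, Order.coheight_eq_zero]
  exact hm

end

section

variable {A : Type*} [CommRing A] [IsDomain A] [IsNoetherianRing A] {p : ℕ} [Fact p.Prime]
  [CharP A p]

theorem IsFFinite.height_add_residueRank_eq (hA : IsFFinite A p) (q : PrimeSpectrum A) :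
    Order.height q + residueRank p q = residueRank p (⊥ : PrimeSpectrum A) :=
  hA.height_add_residueRank fun _ hP _ ↦ by rw [isMin_iff_eq_bot.mp hP]

/-- Height plus rank equals the rank of `⊥`, which bounds all heights uniformly. -/
theorem IsFFinite.coheight_bot_ne_top (hA : IsFFinite A p) :
    Order.coheight (⊥ : PrimeSpectrum A) ≠ ⊤ := by
  have h : Order.krullDim (PrimeSpectrum A) = Order.coheight (⊥ : PrimeSpectrum A) :=
    ringKrullDim_eq_of_isIntegral (R := A) Function.injective_id
  rw [Order.krullDim_eq_iSup_height_of_nonempty, WithBot.coe_inj] at h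
  rw [← h]
  refine ne_top_of_le_ne_top (ENat.natCast_ne_top (residueRank p (⊥ : PrimeSpectrum A)))
    (iSup_le fun q ↦ ?_)
  rw [← hA.height_add_residueRank_eq q]
  exact le_self_add

theorem IsFFinite.residueRank_eq_of_isMax (hA : IsFFinite A p) (h : IsEquicodimensionalRing A)
    {m m' : PrimeSpectrum A} (hm : IsMax m) (hm' : IsMax m') :
    residueRank p m = residueRank p m' := by
  have h1 := hA.height_add_residueRank_eq m
  have h2 := hA.height_add_residueRank_eq m'
  rw [h.height_eq hm hm'] at h1
  have h3 := h1.trans h2.symm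
  have hne : Order.height m' ≠ ⊤ := fun ht ↦ by simp [ht] at h2
  exact ENat.natCast_inj.mp (WithTop.add_left_cancel hne h3)

end

section

variable {A R : Type*} [CommRing A] [IsDomain A] [IsNoetherianRing A] [CommRing R] [Algebra A R]
  [Module.Finite A R] {p : ℕ} [Fact p.Prime] [CharP A p]

/-- A nonzero prime of `A` has coheight strictly below that of `⊥` because the latter is finite. -/
theorem IsFFinite.coheight_eq_coheight_bot_iff (hA : IsFFinite A p) {P : PrimeSpectrum R} :
    Order.coheight P = Order.coheight (⊥ : PrimeSpectrum A) ↔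
      P.comap (algebraMap A R) = ⊥ := by
  rw [← PrimeSpectrum.coheight_comap (A := A)]
  refine ⟨fun h ↦ ?_, fun h ↦ by rw [h]⟩
  by_contra hne
  have := Order.coheight_add_one_le (bot_lt_iff_ne_bot.mpr hne)
  rw [h] at this
  exact this.not_gt (ENat.lt_add_one_iff hA.coheight_bot_ne_top |>.mpr le_rfl)

theorem IsFFinite.isEquidimensionalRing_iff (hA : IsFFinite A p)
    (hAR : Function.Injective (algebraMap A R)) :
    IsEquidimensionalRing R ↔ ∀ P : PrimeSpectrum R, IsMin P → P.comap (algebraMap A R) = ⊥ := by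
  rw [_root_.isEquidimensionalRing_iff]
  obtain ⟨P₀, hP₀, hP₀'⟩ := PrimeSpectrum.exists_isMin_comap_eq_bot hAR
  constructor
  · intro h P hP
    rw [← hA.coheight_eq_coheight_bot_iff, h P P₀ hP hP₀, hA.coheight_eq_coheight_bot_iff, hP₀']
  · intro h P P' hP hP'
    rw [hA.coheight_eq_coheight_bot_iff.mpr (h P hP), hA.coheight_eq_coheight_bot_iff.mpr (h P' hP')]

theorem IsFFinite.finiteRingKrullDim (hA : IsFFinite A p)
    (hAR : Function.Injective (algebraMap A R)) : FiniteRingKrullDim R := by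
  rw [finiteRingKrullDim_iff_ne_bot_and_top, ringKrullDim_eq_of_isIntegral hAR]
  exact ⟨WithBot.coe_ne_bot, fun h ↦ hA.coheight_bot_ne_top (WithBot.coe_injective h)⟩

variable [CharP R p]

theorem IsFFinite.isBiequidimensionalRing_of_finite (hA : IsFFinite A p)
    (hAR : Function.Injective (algebraMap A R)) (hAe : IsEquicodimensionalRing A)
    (hR : ∀ P : PrimeSpectrum R, IsMin P → P.comap (algebraMap A R) = ⊥) :
    IsBiequidimensionalRing R := by
  have : Nontrivial R := hAR.nontrivial
  have : IsNoetherianRing R := IsNoetherianRing.of_finite A R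
  obtain ⟨m, hm⟩ := Ideal.exists_maximal A
  have hm' : IsMax (⟨m, hm.isPrime⟩ : PrimeSpectrum A) := PrimeSpectrum.isMax_iff.mpr hm
  refine hA.of_finite.isBiequidimensionalRing (N := residueRank p (⊥ : PrimeSpectrum A))
    (c := residueRank p (⟨m, hm.isPrime⟩ : PrimeSpectrum A)) (fun P hP ↦ ?_) (fun n hn ↦ ?_)
  · rw [← residueRank_comap (A := A), hR P hP]
  · rw [← residueRank_comap (A := A)]
    exact hA.residueRank_eq_of_isMax hAe (PrimeSpectrum.isMax_comap hn) hm'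

/-- For a minimal prime `P ≤ q` of a locally equidimensional finite extension `R` of an
equicodimensional `F`-finite Noetherian domain `A`, the number
`[κ(q)^{1/p^e} : κ(q)] * p ^ (e * dim R_q)` is determined by `dim A - dim (R / P)`. -/
theorem IsFFinite.exists_kunzFunction_mul_eq (hA : IsFFinite A p)
    (hAe : IsEquicodimensionalRing A)
    (hR : IsLocallyEquidimensionalRing R) (e : ℕ) {P q : PrimeSpectrum R} (hP : IsMin P)
    (hPq : P ≤ q) : ∃ n : ℕ, natKrullDim A = natKrullDim (R ⧸ P.asIdeal) + n ∧
      residueDegree p e (⊥ : PrimeSpectrum A) = p ^ (e * n) * kunzFunction p e q := by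
  have : IsNoetherianRing R := IsNoetherianRing.of_finite A R
  have hRF : IsFFinite R p := hA.of_finite
  have hk : kunzFunction p e q = residueDegree p e P :=
    hRF.kunzFunction_eq e (c := residueRank p P) (fun P' hP' hPq' ↦
      hRF.residueRank_eq_of_locallyEquidimensional hR hP' hPq' hP hPq) hP hPq
  obtain ⟨n, h1, h2⟩ := hA.exists_residueDegree_eq e
    (bot_le : ⊥ ≤ P.comap (algebraMap A R))
  refine ⟨n, ?_, by rw [h2, hk, residueDegree_comap]⟩
  obtain ⟨m, hm⟩ := Ideal.exists_maximal A
  have hm' : IsMax (⟨m, hm.isPrime⟩ : PrimeSpectrum A) := PrimeSpectrum.isMax_iff.mpr hm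
  -- All maximal ideals of `A` have the same rank, so coheights are ranks up to a constant, and the
  -- rank difference `n` is also `dim A - dim (R / P)`.
  have hc := hA.coheight_add_eq fun m hm ↦ hA.residueRank_eq_of_isMax hAe hm hm'
  have hb := hc ⊥
  have hp := hc (P.comap (algebraMap A R))
  rw [PrimeSpectrum.coheight_comap] at hp
  obtain ⟨d, hd⟩ := ENat.ne_top_iff_exists.mp hA.coheight_bot_ne_top
  obtain ⟨d', hd'⟩ := ENat.ne_top_iff_exists.mp (fun h ↦ by simp [h] at hp : Order.coheight P ≠ ⊤)
  have e1 : natKrullDim A = d := natKrullDim_eq <| by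
    rw [ringKrullDim_eq_of_isIntegral (A := A) (R := A) Function.injective_id, ← hd]; rfl
  have e2 : natKrullDim (R ⧸ P.asIdeal) = d' := natKrullDim_eq <| by
    rw [PrimeSpectrum.ringKrullDim_quotient_eq_coheight, ← hd']; rfl
  rw [← hd] at hb
  rw [← hd'] at hp
  norm_cast at hb hp
  omega

end

/-! ### The theorem -/

theorem mainTheorem6 {A R K : Type*} [CommRing A] [IsDomain A] [IsNoetherianRing A]
    [CommRing R] [Algebra A R] [Module.Finite A R] (hAR : Function.Injective (algebraMap A R))
    [Field K] [Algebra A K] [IsFractionRing A K]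
    (p : ℕ) [Fact p.Prime] [CharP A p] [CharP R p] [CharP K p] (hA : IsFFinite A p)
    (e : ℕ) (he : 0 < e) :
    -- all dimensions and degrees that occur below are finite
    (FiniteRingKrullDim A ∧ FiniteRingKrullDim R ∧ 0 < frobeniusDegree K p e ∧
      ∀ q : PrimeSpectrum R, 0 < residueDegree p e q) ∧
    -- (1)
    (∀ P : PrimeSpectrum R, ringKrullDim (R ⧸ P.asIdeal) = ringKrullDim R ↔
      P.asIdeal.comap (algebraMap A R) = ⊥) ∧
    -- (2)
    (IsEquidimensionalRing R ↔ ∀ P ∈ minimalPrimes R, P.comap (algebraMap A R) = ⊥) ∧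
    -- (3)
    (IsEquicodimensionalRing A → IsLocallyEquidimensionalRing R →
      IsBiequidimensionalRing A ∧
      ∀ P ∈ minimalPrimes R, ∀ q : PrimeSpectrum R, P ≤ q.asIdeal →
        (kunzFunction p e q : ℚ) = (frobeniusDegree K p e : ℚ) *
          (p : ℚ) ^ ((e : ℤ) * ((natKrullDim (R ⧸ P) : ℤ) - (natKrullDim A : ℤ)))) ∧
    -- (4)
    (IsEquicodimensionalRing A → IsEquidimensionalRing R → IsBiequidimensionalRing R) ∧
    -- (5)
    (IsEquicodimensionalRing A → IsEquidimensionalRing R →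
      ∀ q : PrimeSpectrum R, kunzFunction p e q = frobeniusDegree K p e) ∧
    -- (6)
    (IsEquicodimensionalRing A → IsLocallyEquidimensionalRing R →
      (∃ c : ℕ, ∀ q : PrimeSpectrum R, kunzFunction p e q = c) → IsEquidimensionalRing R) := by
  have hRN : IsNoetherianRing R := IsNoetherianRing.of_finite A R
  have hRF : IsFFinite R p := hA.of_finite
  have hK : residueDegree p e (⊥ : PrimeSpectrum A) = frobeniusDegree K p e :=
    residueDegree_bot p e
  have hKpos : 0 < frobeniusDegree K p e :=
    hK ▸ residueDegree_pos p (hA.iterateFrobenius_finite e) _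
  have hp : 0 < p := (Fact.out : p.Prime).pos
  have hcomap : ∀ P : PrimeSpectrum R, P.comap (algebraMap A R) = ⊥ ↔
      P.asIdeal.comap (algebraMap A R) = ⊥ := fun P ↦ PrimeSpectrum.ext_iff
  refine ⟨⟨hA.finiteRingKrullDim Function.injective_id, hA.finiteRingKrullDim hAR, hKpos,
    residueDegree_pos p (hRF.iterateFrobenius_finite e)⟩, fun P ↦ ?_, ?_, ?_, ?_, ?_, ?_⟩
  · rw [PrimeSpectrum.ringKrullDim_quotient_eq_coheight, ringKrullDim_eq_of_isIntegral hAR,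
      WithBot.coe_inj, hA.coheight_eq_coheight_bot_iff, hcomap]
  · rw [hA.isEquidimensionalRing_iff hAR]
    exact ⟨fun h P hP ↦ (hcomap _).mp (h ⟨P, hP.1.1⟩ (PrimeSpectrum.isMin_iff.mpr hP)),
      fun h P hP ↦ (hcomap P).mpr (h _ (PrimeSpectrum.isMin_iff.mp hP))⟩
  · intro hAe hR
    refine ⟨hA.isBiequidimensionalRing_of_finite Function.injective_id hAe fun P hP ↦
      isMin_iff_eq_bot.mp hP, fun P hP q hPq ↦ ?_⟩
    obtain ⟨n, hn, h⟩ := hA.exists_kunzFunction_mul_eq hAe hR e (P := ⟨P, hP.1.1⟩) (q := q)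
      (PrimeSpectrum.isMin_iff.mpr hP) hPq
    -- Since `dim (R / P) ≤ dim A`, the exponent is at most zero; hence the integer power over `ℚ`.
    have hexp : (e : ℤ) * ((natKrullDim (R ⧸ P) : ℤ) - (natKrullDim A : ℤ)) = -((e * n : ℕ) : ℤ) := by
      rw [hn]; push_cast; ring
    rw [hexp, zpow_neg, zpow_natCast, ← hK, h]
    push_cast
    have : (p : ℚ) ^ (e * n) ≠ 0 := by positivity
    field_simp
  · intro hAe hR
    exact hA.isBiequidimensionalRing_of_finite hAR hAe ((hA.isEquidimensionalRing_iff hAR).mp hR)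
  · intro hAe hR q
    have hbot := (hA.isEquidimensionalRing_iff hAR).mp hR
    obtain ⟨P, hP, hPq⟩ := PrimeSpectrum.exists_isMin_le q
    rw [hRF.kunzFunction_eq e (c := residueRank p (⊥ : PrimeSpectrum A)) (fun P hP _ ↦ by
      rw [← residueRank_comap (A := A), hbot P hP]) hP hPq, ← hK, ← residueDegree_comap (A := A),
      hbot P hP]
  · rintro hAe hR ⟨c, hc⟩
    rw [hA.isEquidimensionalRing_iff hAR]
    obtain ⟨P₀, hP₀, hP₀'⟩ := PrimeSpectrum.exists_isMin_comap_eq_bot hAR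
    intro P hP
    obtain ⟨n, h1, h2⟩ := hA.exists_residueDegree_eq e
      (bot_le : ⊥ ≤ P.comap (algebraMap A R))
    -- The only minimal prime below a minimal prime is itself, so no equidimensionality is needed.
    -- Comparing `P` with `P₀`, which lies over `⊥`, forces `p ^ (e * n) = 1`; as `e > 0`, the
    -- contraction of `P` has the rank of `⊥`, hence equals it.
    have hkey : ∀ Q : PrimeSpectrum R, IsMin Q →
        kunzFunction p e Q = residueDegree p e (Q.comap (algebraMap A R)) := fun Q hQ ↦ by
      rw [residueDegree_comap]
      exact hRF.kunzFunction_eq e (c := residueRank p Q)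
        (fun P' hP' h ↦ by rw [h.antisymm (hQ h)]) hQ le_rfl
    rw [← hkey P hP, hc P, ← hc P₀, hkey P₀ hP₀, hP₀', hK] at h2
    have hpow : p ^ (e * n) = 1 := by
      have := Nat.eq_of_mul_eq_mul_right hKpos ((one_mul _).trans h2)
      exact this.symm
    have hn : n = 0 := by
      have := (Nat.pow_eq_one.mp hpow).resolve_left (Fact.out : p.Prime).ne_one
      rcases Nat.mul_eq_zero.mp this with h | h
      · omega
      · exact h
    by_contra hne
    have := hA.residueRank_strictAnti (bot_lt_iff_ne_bot.mpr hne)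
    omega
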